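/- Let $\mathbf{k}$ be a field and let $X,Y\subset\mathbb{R}$ be finite sets; order $X\times Y$ by $(s_x,s_y)\le(t_x,t_y)$ iff $s_x\le t_x$ and $s_y\le t_y$. A persistence module $M$ over a poset $P$ consists of $\mathbf{k}$-vector spaces $M_t$ ($t\in P$) and linear maps $\rho_s^t\colon M_s\to M_t$ ($s\le t$) with $\rho_s^s=\mathrm{id}$ and $\rho_t^r\circ\rho_s^t=\rho_s^r$ for $s\le t\le r$; it is pointwise finite-dimensional (pfd) if every $M_t$ is finite-dimensional. Direct sums and isomorphisms of persistence modules are pointwise and natural. An interval of $P$ is a nonempty subset that is convex and zigzag path-connected. For an interval $Q\subseteq P$, the indicator module $\mathbf{k}_Q$ has $(\mathbf{k}_Q)_t=\mathbf{k}$ for $t\in Q$ and $0$ otherwise, its map from $s$ to $t$ being the identity if $s,t\in Q$ and $0$ otherwise. If $M\cong\bigoplus_{Q\in B}\mathbf{k}_Q$ for a multiset $B$ of intervals, $B$ is called the barcode of $M$. A persistence module $M$ over $X\times Y$ is *rectangle-decomposable* if it is isomorphic to a direct sum of indicator modules $\mathbf{k}_R$ of rectangles, i.e. of nonempty sets $R=I\times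 J$ with $I$ an interval of $X$ and $J$ an interval of $Y$. It is *weakly exact* if for all $s\le t$ in $X\times Y$ the commutative square $$\begin{array}{ccc} M_{(s_x,t_y)} & \to & M_t\\ \uparrow & & \uparrow\\ M_s & \to & M_{(t_x,s_y)}\end{array}$$ regarded as a persistence module over $\{0,1\}^2=\{a=(0,0),\,b=(1,0),\,c=(0,1),\,d=(1,1)\}$ (with $M_s$ at $a$, $M_{(t_x,s_y)}$ at $b$, $M_{(s_x,t_y)}$ at $c$, $M_t$ at $d$), has a barcode consisting of elements of $$\mathcal{R}=\{\{a\},\{b\},\{c\},\{d\},\{a,b\},\{a,c\},\{b,d\},\{c,d\},\{a,b,c,d\}\}.$$ **Theorem.** Let $M$ be a pfd persistence module over $X\times Y$ with $X,Y$ finite subsets of $\mathbb{R}$. Then $M$ is rectangle-decomposable if and only if $M$ is weakly exact. -/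

import Mathlib

universe u v v' w w'

/-- A persistence module over a poset `P`: a vector space `space t` for each `t : P` and linear
maps `map h : space s → space t` for `h : s ≤ t`, with `map (s ≤ s) = id` and
`map (t ≤ r) ∘ map (s ≤ t) = map (s ≤ r)`. -/
structure PersistenceModule (k : Type u) [Field k] (P : Type w) [Preorder P] where
  space : P → Type v
  [addCommGroup : ∀ t, AddCommGroup (space t)]
  [module : ∀ t, Module k (space t)]
  map : ∀ {s t : P}, s ≤ t → (space s →ₗ[k] space t)
  map_refl : ∀ t : P, map (le_refl t) = LinearMap.id
  map_trans : ∀ {s t r : P} (hst : s ≤ t) (htr : t ≤ r),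
    map htr ∘ₗ map hst = map (hst.trans htr)

namespace PersistenceModule

attribute [instance] PersistenceModule.addCommGroup PersistenceModule.module

section general

variable {k : Type u} [Field k] {P : Type w} [Preorder P]

/-- Pointwise finite-dimensional (pfd) persistence modules. -/
def IsPfd (M : PersistenceModule.{u, v, w} k P) : Prop :=
  ∀ t : P, FiniteDimensional k (M.space t)

/-- Two persistence modules are isomorphic if there is a natural isomorphism between them. -/
def IsIsomorphic (M : PersistenceModule.{u, v, w} k P) (N : PersistenceModule.{u, v', w} k P) :
    Prop :=
  ∃ e : ∀ t : P, M.space t ≃ₗ[k] N.space t,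
    ∀ (s t : P) (h : s ≤ t) (x : M.space s), e t (M.map h x) = N.map h (e s x)

/-- Restriction (pullback) of a persistence module along a monotone map. -/
def comap {P' : Type w'} [Preorder P'] (M : PersistenceModule.{u, v, w} k P) (f : P' →o P) :
    PersistenceModule.{u, v, w'} k P' where
  space t := M.space (f t)
  map h := M.map (f.monotone h)
  map_refl t := M.map_refl (f t)
  map_trans hst htr := M.map_trans (f.monotone hst) (f.monotone htr)

open DirectSum in
/-- The pointwise direct sum of a family of persistence modules. -/
def directSum {ι : Type} (M : ι → PersistenceModule.{u, v, w} k P) :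
    PersistenceModule.{u, v, w} k P where
  space t := ⨁ i, (M i).space t
  map h := DirectSum.lmap fun i => (M i).map h
  map_refl t := by
    ext i x
    simp [map_refl]
  map_trans hst htr := by
    rw [← DirectSum.lmap_comp]
    simp only [map_trans]

open Classical in
/-- The value at `t` of the indicator module of `Q`: it is `k` if `t ∈ Q` and `0` otherwise. -/
noncomputable def indicatorSpace (k : Type u) [Field k] (Q : Set P) (t : P) : Submodule k k :=
  if t ∈ Q then ⊤ else ⊥

open Classical in
/-- The structure map of the indicator module of `Q`: it is the identity of `k` if both indices
lie in `Q`, and `0` otherwise. -/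
noncomputable def indicatorMap (k : Type u) [Field k] (Q : Set P) (s t : P) :
    indicatorSpace k Q s →ₗ[k] indicatorSpace k Q t :=
  if h : s ∈ Q ∧ t ∈ Q then
    Submodule.inclusion (by simp [indicatorSpace, h.1, h.2])
  else 0

/-- The indicator module of a convex subset `Q` of the poset. Convexity is what makes the structure
maps compose. -/
noncomputable def indicator (k : Type u) [Field k] (Q : Set P) (hQ : Q.OrdConnected) :
    PersistenceModule.{u, u, w} k P where
  space t := indicatorSpace k Q t
  map {s t} _ := indicatorMap k Q s t
  map_refl t := by
    ext ⟨x, hx⟩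
    by_cases h : t ∈ Q
    · simp [indicatorMap, h]
    · simp [indicatorSpace, h] at hx
      simp [indicatorMap, h, hx]
  map_trans {s t r} hst htr := by
    ext ⟨x, hx⟩
    by_cases hs : s ∈ Q
    · by_cases hr : r ∈ Q
      · have ht : t ∈ Q := hQ.out hs hr ⟨hst, htr⟩
        simp [indicatorMap, hs, ht, hr]
      · simp [indicatorMap, hr]
    · simp [indicatorMap, hs]

/-- Intervals of a poset: nonempty subsets that are convex and zigzag path-connected. -/
structure IsInterval (Q : Set P) : Prop where
  nonempty : Q.Nonempty
  ordConnected : Q.OrdConnected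
  zigzag : ∀ p ∈ Q, ∀ q ∈ Q,
    Relation.ReflTransGen (fun x y => x ∈ Q ∧ y ∈ Q ∧ (x ≤ y ∨ y ≤ x)) p q

/-- `M` has as barcode the multiset of intervals given by the indexed family `B`, i.e. `M` is
isomorphic to the direct sum of the indicator modules of the members of `B`. -/
def HasBarcode (M : PersistenceModule.{u, v, w} k P) {ι : Type} (B : ι → Set P) : Prop :=
  ∃ hB : ∀ i, IsInterval (B i),
    IsIsomorphic M (directSum fun i => indicator k (B i) (hB i).ordConnected)

end general

section bimodules

variable {k : Type u} [Field k] {α : Type w} {β : Type w'} [LinearOrder α] [LinearOrder β]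

/-- Rectangles of `α × β`: products of an interval of `α` and an interval of `β`. If `α` is a
subset of `ℝ`, its intervals are the traces on `α` of the intervals of `ℝ`. -/
def IsRectangle (R : Set (α × β)) : Prop :=
  ∃ (I : Set α) (J : Set β), I.Nonempty ∧ J.Nonempty ∧ I.OrdConnected ∧ J.OrdConnected ∧
    R = I ×ˢ J

/-- `M` is isomorphic to a direct sum of rectangle modules. -/
def RectangleDecomposable (M : PersistenceModule.{u, v, max w w'} k (α × β)) : Prop :=
  ∃ (ι : Type) (B : ι → Set (α × β)), (∀ i, IsRectangle (B i)) ∧ M.HasBarcode B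

/-- For `s ≤ t`, the map from the square `{0, 1} × {0, 1}` to `α × β` that sends
`(0,0), (1,0), (0,1), (1,1)` to `s, (t_x, s_y), (s_x, t_y), t`. -/
def corners (s t : α × β) (h : s ≤ t) : Fin 2 × Fin 2 →o α × β where
  toFun p := (if p.1 = 0 then s.1 else t.1, if p.2 = 0 then s.2 else t.2)
  monotone' := by
    rintro ⟨i, j⟩ ⟨i', j'⟩ ⟨hi, hj⟩
    obtain ⟨h1, h2⟩ := h
    refine ⟨?_, ?_⟩
    · fin_cases i <;> fin_cases i' <;> simp_all
    · fin_cases j <;> fin_cases j' <;> simp_all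

/-- The set `𝓡` of rectangles of the square with vertices
`a = (0,0)`, `b = (1,0)`, `c = (0,1)`, `d = (1,1)`, namely
`{a}, {b}, {c}, {d}, {a,b}, {a,c}, {b,d}, {c,d}, {a,b,c,d}`. -/
def squareRectangles : Set (Set (Fin 2 × Fin 2)) :=
  {{(0, 0)}, {(1, 0)}, {(0, 1)}, {(1, 1)},
    {(0, 0), (1, 0)}, {(0, 0), (0, 1)}, {(1, 0), (1, 1)}, {(0, 1), (1, 1)},
    {(0, 0), (1, 0), (0, 1), (1, 1)}}

/-- Weak exactness: for all `s ≤ t`, the barcode of the commutative square on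
`M_s, M_(t_x, s_y), M_(s_x, t_y), M_t` consists of elements of `𝓡`. -/
def WeaklyExact (M : PersistenceModule.{u, v, max w w'} k (α × β)) : Prop :=
  ∀ (s t : α × β) (h : s ≤ t), ∃ (ι : Type) (B : ι → Set (Fin 2 × Fin 2)),
    (∀ i, B i ∈ squareRectangles) ∧ (M.comap (corners s t h)).HasBarcode B

end bimodules

end PersistenceModule

/-!
Both conditions are equivalent to the linear-algebraic condition `IsExact`: in every square
`a = (i, j)`, `b = (i', j)`, `c = (i, j')`, `d = (i', j')` with `i ≤ i'`, `j ≤ j'`, the images in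
`M_d` of `M_b` and `M_c` meet in the image of `M_a`, and the kernel of `M_a → M_d` is the sum of the
kernels of `M_a → M_b` and `M_a → M_c`.

A direct sum of rectangle modules satisfies this, as is checked summand by summand
(`RectangleDecomposable.isExact`). Since `𝓡` is exactly the set of rectangles of `{0, 1}²`
(`mem_squareRectangles_iff`), this applies to the squares of a weakly exact module, so weak
exactness gives `IsExact`. Conversely, `IsExact` passes to the squares, and the decomposition theorem
`IsExact.rectangleDecomposable`, used on `{0, 1}²`, gives them barcodes in `𝓡`. The same theorem
on `X × Y` gives the other implication.

The decomposition theorem is an induction on the total dimension, which needs one rectangle summand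
of a nonzero exact `M` (`IsExact.exists_splitting`). Let `j` be the lowest row where `M` is nonzero,
and `i` the leftmost place in that row with `M_(i,j) ≠ 0`. Choose `x ≠ 0` in `M_(i,j)` that survives
at as few places of the row `j` as possible. If `x` survives at `(p, j)` and at `(i, q)`, it survives
at `(p, q)`: otherwise `x = y + z` with `y` dying at `(p, j)` and `z` at `(i, q)`, minimality forces
`y = 0`, and then `x = z` dies at `(i, q)`. So `x` survives exactly on a rectangle `R` with lower
corner `(i, j)`. Let `t` be its upper corner. Whatever reaches `M_t` from outside `R` comes from the
zero rows below `j` or from the columns left of `i`. The image of these columns meets the image of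
`x` only in `0`, because in the square concerned the intersection comes from some `M_(i',j)` with
`i' < i`, which is zero. Hence a linear form on `M_t` kills everything from outside `R` and takes
the value `1` on the image of `x`. Pulled back to all of `M`, it splits off the copy of `k_R`
generated by `x`. The complement is again exact, being a direct summand.
-/

namespace PersistenceModule

/-! ### Structure maps and indicator modules -/

section prelim

variable {k : Type u} [Field k] {P : Type w}

theorem map_map [Preorder P] (M : PersistenceModule.{u, v, w} k P) {s t r : P}
    (hst : s ≤ t) (htr : t ≤ r) (x : M.space s) : M.map htr (M.map hst x) = M.map (hst.trans htr) x := by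
  rw [← M.map_trans hst htr, LinearMap.comp_apply]

theorem map_self [Preorder P] (M : PersistenceModule.{u, v, w} k P) {s : P} (h : s ≤ s)
    (x : M.space s) :
    M.map h x = x :=
  LinearMap.congr_fun (M.map_refl s) x

open Classical in
theorem coe_indicatorMap (Q : Set P) (s t : P) (x : indicatorSpace k Q s) :
    (indicatorMap k Q s t x : k) = if s ∈ Q ∧ t ∈ Q then (x : k) else 0 := by
  unfold indicatorMap
  split_ifs <;> simp

theorem indicatorSpace_eq_zero {Q : Set P} {t : P} (h : t ∉ Q) (x : indicatorSpace k Q t) :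
    (x : k) = 0 := by
  have := x.2
  simpa [indicatorSpace, h] using this

theorem mem_indicatorSpace {Q : Set P} {t : P} {c : k} (h : t ∉ Q → c = 0) :
    c ∈ indicatorSpace k Q t := by
  by_cases ht : t ∈ Q
  · simp [indicatorSpace, ht]
  · simp [indicatorSpace, ht, h ht]

end prelim

/-! ### Exactness of sums of rectangle modules -/

section bimodules

variable {k : Type u} [Field k] {α : Type w} {β : Type w'} [LinearOrder α] [LinearOrder β]

theorem IsRectangle.isInterval {R : Set (α × β)} (hR : IsRectangle R) : IsInterval R := by
  obtain ⟨I, J, hI, hJ, hI', hJ', rfl⟩ := hR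
  refine ⟨hI.prod hJ, ⟨?_⟩, ?_⟩
  · rintro p ⟨hp1, hp2⟩ q ⟨hq1, hq2⟩ r ⟨hr1, hr2⟩
    exact ⟨hI'.out hp1 hq1 ⟨hr1.1, hr2.1⟩, hJ'.out hp2 hq2 ⟨hr1.2, hr2.2⟩⟩
  · rintro ⟨p1, p2⟩ hp ⟨q1, q2⟩ hq
    have hm : (p1, q2) ∈ I ×ˢ J := ⟨hp.1, hq.2⟩
    refine (Relation.ReflTransGen.single ⟨hp, hm, ?_⟩).tail ⟨hm, hq, ?_⟩
    · simpa using le_total p1 q1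
    · simpa using le_total p2 q2

/-- Exactness of all squares `(i, j) ≤ (i', j), (i, j') ≤ (i', j')` in terms of images and kernels:
the image of the lower left corner in the upper right one is the intersection of the images of the
other two corners, and its kernel is the sum of the kernels towards them. In both cases only the
nontrivial inclusion is recorded. -/
structure IsExact (M : PersistenceModule.{u, v, max w w'} k (α × β)) : Prop where
  image : ∀ {i i' : α} {j j' : β} (hi : i ≤ i') (hj : j ≤ j')
    (x : M.space (i', j)) (y : M.space (i, j')),
    M.map (Prod.mk_le_mk.2 ⟨le_refl i', hj⟩) x = M.map (Prod.mk_le_mk.2 ⟨hi, le_refl j'⟩) y →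
    ∃ z : M.space (i, j),
      M.map (Prod.mk_le_mk.2 ⟨hi, hj⟩) z = M.map (Prod.mk_le_mk.2 ⟨le_refl i', hj⟩) x
  kernel : ∀ {i i' : α} {j j' : β} (hi : i ≤ i') (hj : j ≤ j') (x : M.space (i, j)),
    M.map (Prod.mk_le_mk.2 ⟨hi, hj⟩) x = 0 →
    ∃ y z : M.space (i, j), x = y + z ∧ M.map (Prod.mk_le_mk.2 ⟨hi, le_refl j⟩) y = 0 ∧
      M.map (Prod.mk_le_mk.2 ⟨le_refl i, hj⟩) z = 0

theorem IsExact.of_isIsomorphic {M : PersistenceModule.{u, v, max w w'} k (α × β)}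
    {N : PersistenceModule.{u, v', max w w'} k (α × β)} (h : M.IsIsomorphic N) (hN : N.IsExact) :
    M.IsExact := by
  obtain ⟨e, he⟩ := h
  constructor
  · intro i i' j j' hi hj x y hxy
    obtain ⟨z, hz⟩ := hN.image hi hj (e _ x) (e _ y) (by rw [← he, ← he, hxy])
    refine ⟨(e _).symm z, (e _).injective ?_⟩
    rw [he, he, LinearEquiv.apply_symm_apply, hz]
  · intro i i' j j' hi hj x hx
    obtain ⟨y, z, hyz, hy, hz⟩ := hN.kernel hi hj (e _ x) (by rw [← he, hx, map_zero])
    refine ⟨(e _).symm y, (e _).symm z, ?_, (e _).injective ?_, (e _).injective ?_⟩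
    · rw [← map_add, ← hyz, LinearEquiv.symm_apply_apply]
    · rw [he, LinearEquiv.apply_symm_apply, hy, map_zero]
    · rw [he, LinearEquiv.apply_symm_apply, hz, map_zero]

open Classical in
/-- A rectangle that contains two opposite corners `(i', j)`, `(i, j')` of a square contains the other
two as well. The required elements are obtained from the maps `indicatorMap`, which are defined
between any two points, so that they can be applied backwards. -/
theorem isExact_directSum_indicator {ι : Type} {B : ι → Set (α × β)}
    (hB : ∀ i, IsRectangle (B i)) (hB' : ∀ i, (B i).OrdConnected) :
    (directSum fun i => indicator k (B i) (hB' i)).IsExact := by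
  have corner : ∀ (l : ι) (i i' : α) (j j' : β), (i', j) ∈ B l → (i, j') ∈ B l →
      (i, j) ∈ B l ∧ (i', j') ∈ B l := by
    intro l i i' j j'
    obtain ⟨I, J, -, -, -, -, hIJ⟩ := hB l
    simp only [hIJ, Set.mem_prod]
    tauto
  constructor
  · intro i i' j j' hi hj (x : DirectSum ι fun l => indicatorSpace k (B l) (i', j))
      (y : DirectSum ι fun l => indicatorSpace k (B l) (i, j'))
      (hxy : DirectSum.lmap (fun l => indicatorMap k (B l) (i', j) (i', j')) x =
        DirectSum.lmap (fun l => indicatorMap k (B l) (i, j') (i', j')) y)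
    refine ⟨DirectSum.lmap (fun l => indicatorMap k (B l) (i', j) (i, j)) x, ?_⟩
    change DirectSum.lmap (fun l => indicatorMap k (B l) (i, j) (i', j'))
        (DirectSum.lmap (fun l => indicatorMap k (B l) (i', j) (i, j)) x) =
      DirectSum.lmap (fun l => indicatorMap k (B l) (i', j) (i', j')) x
    refine DFinsupp.ext fun l => Subtype.ext ?_
    have hl : (indicatorMap k (B l) (i', j) (i', j') (x l) : k) =
        indicatorMap k (B l) (i, j') (i', j') (y l) :=
      congrArg Subtype.val (DFunLike.congr_fun hxy l)
    have hc := corner l i i' j j'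
    simp only [DirectSum.lmap_apply, coe_indicatorMap] at hl ⊢
    split_ifs at hl ⊢ <;> first | rfl | exact hl | exact hl.symm | tauto
  · intro i i' j j' hi hj (x : DirectSum ι fun l => indicatorSpace k (B l) (i, j))
      (hx : DirectSum.lmap (fun l => indicatorMap k (B l) (i, j) (i', j')) x = 0)
    -- `z` keeps the components of `x` on the rectangles that contain both `(i, j)` and `(i', j)`.
    let z : DirectSum ι fun l => indicatorSpace k (B l) (i, j) :=
      DirectSum.lmap (fun l => indicatorMap k (B l) (i', j) (i, j))
        (DirectSum.lmap (fun l => indicatorMap k (B l) (i, j) (i', j)) x)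
    refine ⟨x - z, z, (sub_add_cancel x z).symm, ?_, ?_⟩
    · change DirectSum.lmap (fun l => indicatorMap k (B l) (i, j) (i', j)) (x - z) = 0
      refine DFinsupp.ext fun l => Subtype.ext ?_
      rw [map_sub, DirectSum.sub_apply, AddSubgroupClass.coe_sub]
      simp only [z, DirectSum.lmap_apply, coe_indicatorMap]
      split_ifs <;> first | exact sub_self _ | tauto
    · change DirectSum.lmap (fun l => indicatorMap k (B l) (i, j) (i, j')) z = 0
      refine DFinsupp.ext fun l => Subtype.ext ?_
      have hl : (indicatorMap k (B l) (i, j) (i', j') (x l) : k) = 0 :=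
        congrArg Subtype.val (DFunLike.congr_fun hx l)
      have hc := corner l i i' j j'
      simp only [z, DirectSum.lmap_apply, coe_indicatorMap] at hl ⊢
      split_ifs at hl ⊢ <;> first | rfl | exact hl | exact hl.symm | tauto

theorem RectangleDecomposable.isExact {M : PersistenceModule.{u, v, max w w'} k (α × β)}
    (h : M.RectangleDecomposable) : M.IsExact := by
  obtain ⟨ι, B, hB, hB', hM⟩ := h
  exact .of_isIsomorphic hM (isExact_directSum_indicator hB _)

end bimodules

/-! ### Rectangles of the square and weak exactness -/

section square

theorem mem_squareRectangles_iff {R : Set (Fin 2 × Fin 2)} :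
    R ∈ squareRectangles ↔ IsRectangle R := by
  have conn : ∀ I : Set (Fin 2), I.OrdConnected := by
    refine fun I => ⟨fun x hx y hy z hz => ?_⟩
    have : z = x ∨ z = y := by
      have := hz.1; have := hz.2; omega
    rcases this with rfl | rfl <;> assumption
  constructor
  · intro h
    have key : ∃ I J : Set (Fin 2), I.Nonempty ∧ J.Nonempty ∧ R = I ×ˢ J := by
      simp only [squareRectangles, Set.mem_insert_iff, Set.mem_singleton_iff] at h
      rcases h with rfl | rfl | rfl | rfl | rfl | rfl | rfl | rfl | rfl
      · exact ⟨{0}, {0}, by simp, by simp, by simp⟩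
      · exact ⟨{1}, {0}, by simp, by simp, by simp⟩
      · exact ⟨{0}, {1}, by simp, by simp, by simp⟩
      · exact ⟨{1}, {1}, by simp, by simp, by simp⟩
      · exact ⟨{0, 1}, {0}, by simp, by simp, by ext ⟨a, b⟩; fin_cases a <;> fin_cases b <;> simp⟩
      · exact ⟨{0}, {0, 1}, by simp, by simp, by ext ⟨a, b⟩; fin_cases a <;> fin_cases b <;> simp⟩
      · exact ⟨{1}, {0, 1}, by simp, by simp, by ext ⟨a, b⟩; fin_cases a <;> fin_cases b <;> simp⟩
      · exact ⟨{0, 1}, {1}, by simp, by simp, by ext ⟨a, b⟩; fin_cases a <;> fin_cases b <;> simp⟩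
      · exact ⟨{0, 1}, {0, 1}, by simp, by simp,
          by ext ⟨a, b⟩; fin_cases a <;> fin_cases b <;> simp⟩
    obtain ⟨I, J, hI, hJ, h⟩ := key
    exact ⟨I, J, hI, hJ, conn I, conn J, h⟩
  · rintro ⟨I, J, hI, hJ, -, -, rfl⟩
    have cases3 : ∀ I : Set (Fin 2), I.Nonempty → I = {0} ∨ I = {1} ∨ I = {0, 1} := by
      intro I hI
      by_cases h0 : 0 ∈ I <;> by_cases h1 : 1 ∈ I
      · exact .inr <| .inr <| by ext a; fin_cases a <;> simp [h0, h1]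
      · exact .inl <| by ext a; fin_cases a <;> simp [h0, h1]
      · exact .inr <| .inl <| by ext a; fin_cases a <;> simp [h0, h1]
      · obtain ⟨a, ha⟩ := hI
        fin_cases a <;> simp_all
    rcases cases3 I hI with rfl | rfl | rfl <;> rcases cases3 J hJ with rfl | rfl | rfl <;>
      simp [squareRectangles, Set.insert_prod, Set.prod_insert, Set.ext_iff, Prod.forall,
        Fin.forall_fin_two]

end square

section squares

variable {k : Type u} [Field k] {α : Type w} {β : Type w'} [LinearOrder α] [LinearOrder β]

/-- The monotone map `corners s t h` is a product of two maps, so it sends squares to squares. -/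
theorem IsExact.comap_corners {M : PersistenceModule.{u, v, max w w'} k (α × β)} (hM : M.IsExact)
    (s t : α × β) (h : s ≤ t) : (M.comap (corners s t h)).IsExact := by
  constructor
  · intro i i' j j' hi hj x y hxy
    have hm : corners s t h (i, j) ≤ corners s t h (i', j') := (corners s t h).monotone ⟨hi, hj⟩
    exact hM.image hm.1 hm.2 x y hxy
  · intro i i' j j' hi hj x hx
    have hm : corners s t h (i, j) ≤ corners s t h (i', j') := (corners s t h).monotone ⟨hi, hj⟩
    exact hM.kernel hm.1 hm.2 x hx

theorem isExact_of_comap_corners {M : PersistenceModule.{u, v, max w w'} k (α × β)}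
    (hM : ∀ (s t : α × β) (h : s ≤ t), (M.comap (corners s t h)).IsExact) : M.IsExact := by
  have h01 : (0 : Fin 2) ≤ 1 := by decide
  constructor
  · intro i i' j j' hi hj x y hxy
    exact (hM (i, j) (i', j') ⟨hi, hj⟩).image h01 h01 x y hxy
  · intro i i' j j' hi hj x hx
    exact (hM (i, j) (i', j') ⟨hi, hj⟩).kernel h01 h01 x hx

theorem WeaklyExact.isExact {M : PersistenceModule.{u, v, max w w'} k (α × β)}
    (hM : M.WeaklyExact) : M.IsExact := by
  refine isExact_of_comap_corners fun s t h => ?_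
  obtain ⟨ι, B, hB, hM⟩ := hM s t h
  exact RectangleDecomposable.isExact ⟨ι, B, fun i => mem_squareRectangles_iff.1 (hB i), hM⟩

end squares

/-! ### Splitting off an indicator module -/

section split

/-- The decomposition of a direct sum over `Option ι` into the summand at `none` and the rest is
natural. -/
theorem lequivProdDirectSum_symm_lmap {k : Type u} [Field k] {ι : Type w} {V : Option ι → Type v}
    {W : Option ι → Type v'} [∀ o, AddCommGroup (V o)] [∀ o, AddCommGroup (W o)]
    [∀ o, Module k (V o)] [∀ o, Module k (W o)] (f : ∀ o, V o →ₗ[k] W o)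
    (y : V none × DirectSum ι fun i => V (some i)) :
    (DirectSum.lequivProdDirectSum k).symm (f none y.1, DirectSum.lmap (fun i => f (some i)) y.2) =
      DirectSum.lmap f ((DirectSum.lequivProdDirectSum k).symm y) := by
  rw [LinearEquiv.symm_apply_eq]
  obtain ⟨z, rfl⟩ := (DirectSum.lequivProdDirectSum k).surjective y
  rw [LinearEquiv.symm_apply_apply]
  exact Prod.ext rfl (DFinsupp.ext fun i => rfl)

variable {k : Type u} [Field k] {P : Type w} [Preorder P]

/-- A morphism from the indicator module of `R` to `M` together with a retraction. The morphism is
given by the images `vec p` of `1 ∈ k`, the retraction by the linear forms `form p`; both vanish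
outside `R`. Naturality is stated only where it does not follow from this vanishing:
`map_vec` includes that `vec p` dies when `p ∈ R` and `q ∉ R`, and `form_map` that `form q` kills what
comes from outside `R`. -/
structure IndicatorSplitting (M : PersistenceModule.{u, v, w} k P) (R : Set P) where
  vec : ∀ p, M.space p
  form : ∀ p, M.space p →ₗ[k] k
  vec_eq_zero : ∀ p, p ∉ R → vec p = 0
  form_eq_zero : ∀ p, p ∉ R → form p = 0
  form_vec : ∀ p, p ∈ R → form p (vec p) = 1
  map_vec : ∀ {p q} (h : p ≤ q), p ∈ R → M.map h (vec p) = vec q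
  form_map : ∀ {p q} (h : p ≤ q), q ∈ R → ∀ x, form q (M.map h x) = form p x

namespace IndicatorSplitting

variable {M : PersistenceModule.{u, v, w} k P} {R : Set P} (S : M.IndicatorSplitting R)

/-- The kernel of the retraction, a complement in `M` of the copy of `k_R`. -/
def compl : PersistenceModule.{u, v, w} k P where
  space p := LinearMap.ker (S.form p)
  map {p q} h := (M.map h).restrict fun x hx => by
    rw [LinearMap.mem_ker] at *
    by_cases hq : q ∈ R
    · rw [S.form_map h hq, hx]
    · rw [S.form_eq_zero q hq, LinearMap.zero_apply]
  map_refl p := LinearMap.ext fun x => Subtype.ext (M.map_self le_rfl x.1)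
  map_trans hst htr := LinearMap.ext fun x => Subtype.ext (M.map_map hst htr x.1)

theorem map_form_smul_vec {p q : P} (h : p ≤ q) (x : M.space p) :
    M.map h (S.form p x • S.vec p) = S.form q (M.map h x) • S.vec q := by
  rw [map_smul]
  by_cases hp : p ∈ R
  · rw [S.map_vec h hp]
    by_cases hq : q ∈ R
    · rw [S.form_map h hq]
    · rw [S.vec_eq_zero q hq, smul_zero, smul_zero]
  · rw [S.vec_eq_zero p hp, map_zero, smul_zero]
    by_cases hq : q ∈ R
    · rw [S.form_map h hq, S.form_eq_zero p hp, LinearMap.zero_apply, zero_smul]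
    · rw [S.vec_eq_zero q hq, smul_zero]

/-- The inclusion of the complement into `M`. -/
def incl (p : P) : S.compl.space p →ₗ[k] M.space p := (LinearMap.ker (S.form p)).subtype

theorem incl_injective (p : P) : Function.Injective (S.incl p) := Subtype.val_injective

theorem form_incl {p : P} (x : S.compl.space p) : S.form p (S.incl p x) = 0 :=
  LinearMap.mem_ker.1 x.2

theorem incl_map {p q : P} (h : p ≤ q) (x : S.compl.space p) :
    S.incl q (S.compl.map h x) = M.map h (S.incl p x) := rfl

/-- The projection of `M` onto the complement along the copy of `k_R`. -/
def proj (p : P) : M.space p →ₗ[k] S.compl.space p :=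
  (LinearMap.id - (S.form p).smulRight (S.vec p)).codRestrict _ fun x => by
    by_cases hp : p ∈ R
    · simp [S.form_vec p hp]
    · simp [S.form_eq_zero p hp]

theorem incl_proj {p : P} (x : M.space p) :
    S.incl p (S.proj p x) = x - S.form p x • S.vec p := rfl

theorem proj_map {p q : P} (h : p ≤ q) (x : M.space p) :
    S.proj q (M.map h x) = S.compl.map h (S.proj p x) := by
  apply S.incl_injective
  rw [incl_map, incl_proj, incl_proj, map_sub, map_form_smul_vec]

theorem proj_incl {p : P} (x : S.compl.space p) : S.proj p (S.incl p x) = x := by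
  apply S.incl_injective
  rw [incl_proj, form_incl, zero_smul, sub_zero]

theorem proj_vec (p : P) : S.proj p (S.vec p) = 0 := by
  apply S.incl_injective
  rw [incl_proj, map_zero]
  by_cases hp : p ∈ R
  · rw [S.form_vec p hp, one_smul, sub_self]
  · rw [S.vec_eq_zero p hp, smul_zero, sub_zero]

/-- The pointwise decomposition of `M` as the product of `k_R` and the complement. -/
noncomputable def equivProd (p : P) : M.space p ≃ₗ[k] indicatorSpace k R p × S.compl.space p :=
  LinearEquiv.ofBijective
    (((S.form p).codRestrict (indicatorSpace k R p) fun x => mem_indicatorSpace fun hp => by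
      rw [S.form_eq_zero p hp, LinearMap.zero_apply]).prod (S.proj p)) <| by
    constructor
    · rw [← LinearMap.ker_eq_bot, LinearMap.ker_eq_bot']
      intro x hx
      have h1 : S.form p x = 0 := congrArg (fun y => (y.1 : k)) hx
      have h2 : S.proj p x = 0 := congrArg Prod.snd hx
      have h3 := S.incl_proj x
      rwa [h1, h2, zero_smul, sub_zero, map_zero, eq_comm] at h3
    · rintro ⟨c, n⟩
      refine ⟨(c : k) • S.vec p + S.incl p n, Prod.ext (Subtype.ext ?_) ?_⟩
      · change S.form p ((c : k) • S.vec p + S.incl p n) = c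
        rw [map_add, map_smul, form_incl, add_zero]
        by_cases hp : p ∈ R
        · rw [S.form_vec p hp, smul_eq_mul, mul_one]
        · rw [indicatorSpace_eq_zero hp, zero_smul]
      · change S.proj p ((c : k) • S.vec p + S.incl p n) = n
        rw [map_add, proj_incl, map_smul, proj_vec, smul_zero, zero_add]

theorem equivProd_map {p q : P} (h : p ≤ q) (x : M.space p) :
    S.equivProd q (M.map h x) =
      (indicatorMap k R p q (S.equivProd p x).1, S.compl.map h (S.equivProd p x).2) := by
  classical
  refine Prod.ext (Subtype.ext ?_) (S.proj_map h x)
  rw [coe_indicatorMap]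
  change S.form q (M.map h x) = if _ then S.form p x else 0
  split_ifs with hpq
  · exact S.form_map h hpq.2 x
  · by_cases hq : q ∈ R
    · rw [S.form_map h hq, S.form_eq_zero p fun hp => hpq ⟨hp, hq⟩, LinearMap.zero_apply]
    · rw [S.form_eq_zero q hq, LinearMap.zero_apply]

theorem hasBarcode (hR : IsInterval R) {ι : Type} {B : ι → Set P} (hB : S.compl.HasBarcode B) :
    M.HasBarcode (fun o : Option ι => o.elim R B) := by
  obtain ⟨hB, e, he⟩ := hB
  have hB' : ∀ o : Option ι, IsInterval (o.elim R B) := by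
    rintro (_ | i)
    exacts [hR, hB i]
  refine ⟨hB', fun p => (S.equivProd p).trans (((LinearEquiv.refl k _).prodCongr (e p)).trans
    (DirectSum.lequivProdDirectSum k
      (α := fun o : Option ι => indicatorSpace k (o.elim R B) p)).symm), fun p q h x => ?_⟩
  simp only [LinearEquiv.trans_apply, equivProd_map]
  generalize S.equivProd p x = y
  refine Eq.trans ?_ (lequivProdDirectSum_symm_lmap
    (fun o : Option ι => indicatorMap k (o.elim R B) p q) (y.1, e p y.2))
  exact congrArg (fun z => (DirectSum.lequivProdDirectSum k
    (α := fun o : Option ι => indicatorSpace k (o.elim R B) q)).symm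
      (indicatorMap k R p q y.1, z)) (he p q h y.2)

theorem isPfd_compl (hM : M.IsPfd) : S.compl.IsPfd := fun p =>
  have := hM p
  inferInstanceAs (FiniteDimensional k (LinearMap.ker (S.form p)))

theorem sum_finrank_compl_lt [Fintype P] (hM : M.IsPfd) (hR : R.Nonempty) :
    ∑ p, Module.finrank k (S.compl.space p) < ∑ p, Module.finrank k (M.space p) := by
  obtain ⟨r, hr⟩ := hR
  refine Finset.sum_lt_sum (fun p _ => ?_) ⟨r, Finset.mem_univ r, ?_⟩
  · have := hM p
    exact Submodule.finrank_le (LinearMap.ker (S.form p))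
  · have := hM r
    refine Submodule.finrank_lt (s := LinearMap.ker (S.form r)) fun h => one_ne_zero (α := k) ?_
    rw [← S.form_vec r hr, LinearMap.ker_eq_top.1 h, LinearMap.zero_apply]

end IndicatorSplitting

end split

/-! ### Decomposition of exact modules -/

section bimodules

variable {k : Type u} [Field k] {α : Type w} {β : Type w'} [LinearOrder α] [LinearOrder β]

/-- The projection onto the complement is a morphism, so it corrects solutions found in `M` to ones
in the complement. -/
theorem IsExact.compl {M : PersistenceModule.{u, v, max w w'} k (α × β)} (hM : M.IsExact)
    {R : Set (α × β)} (S : M.IndicatorSplitting R) : S.compl.IsExact := by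
  constructor
  · intro i i' j j' hi hj x y hxy
    obtain ⟨z, hz⟩ := hM.image hi hj (S.incl _ x) (S.incl _ y)
      (by rw [← S.incl_map, hxy, S.incl_map])
    refine ⟨S.proj _ z, ?_⟩
    rw [← S.proj_map, hz, S.proj_map, S.proj_incl]
  · intro i i' j j' hi hj x hx
    obtain ⟨y, z, hyz, hy, hz⟩ := hM.kernel hi hj (S.incl _ x) (by rw [← S.incl_map, hx, map_zero])
    refine ⟨S.proj _ y, S.proj _ z, ?_, ?_, ?_⟩
    · rw [← map_add, ← hyz, S.proj_incl]
    · rw [← S.proj_map, hy, map_zero]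
    · rw [← S.proj_map, hz, map_zero]

/-- A nonzero module has a lowest nonzero row `j`, and a leftmost place `i` in it where the module is
nonzero. -/
theorem exists_first_nontrivial [Finite α] [Finite β]
    (M : PersistenceModule.{u, v, max w w'} k (α × β)) (hM : ∃ p, Nontrivial (M.space p)) :
    ∃ i j, Nontrivial (M.space (i, j)) ∧ (∀ p, p.2 < j → Subsingleton (M.space p)) ∧
      ∀ i' < i, Subsingleton (M.space (i', j)) := by
  obtain ⟨⟨i₀, j₀⟩, h₀⟩ := hM
  obtain ⟨j, ⟨i₁, h₁⟩, hj⟩ := (wellFounded_lt (α := β)).has_min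
    {j | ∃ i, Nontrivial (M.space (i, j))} ⟨j₀, i₀, h₀⟩
  obtain ⟨i, h, hi⟩ := (wellFounded_lt (α := α)).has_min
    {i | Nontrivial (M.space (i, j))} ⟨i₁, h₁⟩
  refine ⟨i, j, h, fun p hp => ?_, fun i' hi' => ?_⟩
  · exact not_nontrivial_iff_subsingleton.1 fun hn => hj p.2 ⟨p.1, hn⟩ hp
  · exact not_nontrivial_iff_subsingleton.1 fun hn => hi i' hn hi'

/-- A nonzero exact module over a finite grid has a rectangle module as a direct summand. -/
theorem IsExact.exists_splitting [Finite α] [Finite β]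
    {M : PersistenceModule.{u, v, max w w'} k (α × β)} (hM : M.IsExact)
    (hM' : ∃ p, Nontrivial (M.space p)) :
    ∃ R : Set (α × β), IsRectangle R ∧ Nonempty (M.IndicatorSplitting R) := by
  classical
  obtain ⟨i, j, hs, hrow, hcol⟩ := M.exists_first_nontrivial hM'
  -- `I x` and `J x` are the places in row `j` and in column `i` where `x` survives.
  let I (x : M.space (i, j)) : Set α :=
    {p | ∃ h : i ≤ p, M.map (Prod.mk_le_mk.2 ⟨h, le_refl j⟩) x ≠ 0}
  let J (x : M.space (i, j)) : Set β :=
    {q | ∃ h : j ≤ q, M.map (Prod.mk_le_mk.2 ⟨le_refl i, h⟩) x ≠ 0}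
  obtain ⟨x, hx0, hx⟩ := (InvImage.wf (fun x => (I x).ncard) wellFounded_lt).has_min
    {x : M.space (i, j) | x ≠ 0} (exists_ne 0)
  have hI0 : i ∈ I x := ⟨le_rfl, by rwa [M.map_self]⟩
  have hJ0 : j ∈ J x := ⟨le_rfl, by rwa [M.map_self]⟩
  have hI : ∀ {p p'}, i ≤ p → p ≤ p' → p' ∈ I x → p ∈ I x := by
    rintro p p' hp hpp' ⟨hp', h⟩
    refine ⟨hp, fun h0 => h ?_⟩
    rw [← M.map_map (Prod.mk_le_mk.2 ⟨hp, le_refl j⟩) (Prod.mk_le_mk.2 ⟨hpp', le_refl j⟩), h0,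
      map_zero]
  have hJ : ∀ {q q'}, j ≤ q → q ≤ q' → q' ∈ J x → q ∈ J x := by
    rintro q q' hq hqq' ⟨hq', h⟩
    refine ⟨hq, fun h0 => h ?_⟩
    rw [← M.map_map (Prod.mk_le_mk.2 ⟨le_refl i, hq⟩) (Prod.mk_le_mk.2 ⟨le_refl i, hqq'⟩), h0,
      map_zero]
  -- The kernel condition and the minimality of `I x`: `x` survives exactly on `I x ×ˢ J x`.
  have halive : ∀ p (h : (i, j) ≤ p), M.map h x ≠ 0 ↔ p ∈ I x ×ˢ J x := by
    rintro ⟨p, q⟩ h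
    obtain ⟨hp, hq⟩ := Prod.mk_le_mk.1 h
    constructor
    · intro hne
      refine ⟨⟨hp, fun h0 => hne ?_⟩, ⟨hq, fun h0 => hne ?_⟩⟩
      · rw [← M.map_map (Prod.mk_le_mk.2 ⟨hp, le_refl j⟩) (Prod.mk_le_mk.2 ⟨le_refl p, hq⟩), h0,
          map_zero]
      · rw [← M.map_map (Prod.mk_le_mk.2 ⟨le_refl i, hq⟩) (Prod.mk_le_mk.2 ⟨hp, le_refl q⟩), h0,
          map_zero]
    · rintro ⟨hpI, hqJ⟩ h0
      obtain ⟨y, z, hyz, hy, hz⟩ := hM.kernel hp hq x h0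
      have hy0 : y = 0 := by
        by_contra hy0
        refine hx y hy0 (Set.ncard_lt_ncard ?_ (Set.toFinite _))
        refine (Set.ssubset_iff_of_subset ?_).2 ⟨p, hpI, fun ⟨_, h⟩ => h hy⟩
        rintro p' ⟨hp', h'⟩
        refine hI hp' (le_of_not_ge fun hpp' => h' ?_) hpI
        rw [← M.map_map (Prod.mk_le_mk.2 ⟨hp, le_refl j⟩) (Prod.mk_le_mk.2 ⟨hpp', le_refl j⟩), hy,
          map_zero]
      rw [hy0, zero_add] at hyz
      exact hqJ.2 (hyz ▸ hz)
  obtain ⟨t₁, ht₁, hmax₁⟩ := Set.exists_max_image (I x) id (Set.toFinite _) ⟨i, hI0⟩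
  obtain ⟨t₂, ht₂, hmax₂⟩ := Set.exists_max_image (J x) id (Set.toFinite _) ⟨j, hJ0⟩
  have hR : ∀ p, p ∈ I x ×ˢ J x ↔ (i, j) ≤ p ∧ p ≤ (t₁, t₂) := fun p =>
    ⟨fun h => ⟨⟨h.1.1, h.2.1⟩, ⟨hmax₁ _ h.1, hmax₂ _ h.2⟩⟩,
      fun h => ⟨hI h.1.1 h.2.1 ht₁, hJ h.1.2 h.2.2 ht₂⟩⟩
  have hst : (i, j) ≤ (t₁, t₂) := ⟨ht₁.1, ht₂.1⟩
  have hxt : M.map hst x ≠ 0 := (halive _ hst).2 ⟨ht₁, ht₂⟩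
  -- The image condition: what reaches `(t₁, t₂)` from outside the rectangle lies in a subspace `U`
  -- that does not contain the image of `x`.
  have hU : ∃ U : Submodule k (M.space (t₁, t₂)), M.map hst x ∉ U ∧
      ∀ p (h : p ≤ (t₁, t₂)), ¬ (i, j) ≤ p → ∀ y, M.map h y ∈ U := by
    by_cases hi : ∃ i', i' < i
    · obtain ⟨i', hi', hmax⟩ := Set.exists_max_image (Set.Iio i) id (Set.toFinite _) hi
      have hi'' : i' < i := hi'
      have hit : i' ≤ t₁ := hi''.le.trans ht₁.1
      -- With `i'` the predecessor of `i`, everything from the left factors through `(i', t₂)`.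
      refine ⟨LinearMap.range (M.map (Prod.mk_le_mk.2 ⟨hit, le_refl t₂⟩)), ?_, ?_⟩
      · rintro ⟨y, hy⟩
        obtain ⟨z, hz⟩ := hM.image hit ht₂.1
          (M.map (Prod.mk_le_mk.2 ⟨ht₁.1, le_refl j⟩) x) y (by rw [hy, M.map_map])
        have := hcol i' hi'
        rw [M.map_map, Subsingleton.elim z 0, map_zero] at hz
        exact hxt hz.symm
      · rintro ⟨p, q⟩ h hp y
        rw [Prod.mk_le_mk] at h hp
        by_cases hq : q < j
        · have := hrow (p, q) hq
          rw [Subsingleton.elim y 0, map_zero]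
          exact Submodule.zero_mem _
        · have hpi : p ≤ i' := hmax p (lt_of_not_ge fun hp' => hp ⟨hp', le_of_not_gt hq⟩)
          exact ⟨M.map (Prod.mk_le_mk.2 ⟨hpi, h.2⟩) y, M.map_map _ _ y⟩
    · refine ⟨⊥, hxt, ?_⟩
      rintro ⟨p, q⟩ h hp y
      have hq : q < j := lt_of_not_ge fun hq => hp ⟨le_of_not_gt fun hp => hi ⟨p, hp⟩, hq⟩
      have := hrow (p, q) hq
      rw [Subsingleton.elim y 0, map_zero]
      exact Submodule.zero_mem _
  obtain ⟨U, hxU, hU⟩ := hU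
  obtain ⟨φ, hφ, hφU⟩ := Submodule.exists_le_ker_of_notMem hxU
  refine ⟨I x ×ˢ J x, ⟨I x, J x, ⟨i, hI0⟩, ⟨j, hJ0⟩, ?_, ?_, rfl⟩, ⟨
    { vec := fun p => if h : (i, j) ≤ p then M.map h x else 0
      form := fun p => if h : p ≤ (t₁, t₂) then (φ (M.map hst x))⁻¹ • φ ∘ₗ M.map h else 0
      vec_eq_zero := ?_
      form_eq_zero := ?_
      form_vec := ?_
      map_vec := ?_
      form_map := ?_ }⟩⟩
  · exact ⟨fun p hp p' hp' r hr => hI (hp.1.trans hr.1) hr.2 hp'⟩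
  · exact ⟨fun q hq q' hq' r hr => hJ (hq.1.trans hr.1) hr.2 hq'⟩
  · intro p hp
    split_ifs with h
    · exact of_not_not fun hne => hp ((halive p h).1 hne)
    · rfl
  · intro p hp
    split_ifs with h
    · ext y
      have := hφU (hU p h (fun hs => hp ((hR p).2 ⟨hs, h⟩)) y)
      rw [LinearMap.mem_ker] at this
      rw [LinearMap.smul_apply, LinearMap.comp_apply, this, smul_zero, LinearMap.zero_apply]
    · rfl
  · intro p hp
    obtain ⟨h1, h2⟩ := (hR p).1 hp
    rw [dif_pos h1, dif_pos h2, LinearMap.smul_apply, LinearMap.comp_apply, M.map_map, smul_eq_mul,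
      inv_mul_cancel₀ hφ]
  · intro p q h hp
    obtain ⟨h1, h2⟩ := (hR p).1 hp
    rw [dif_pos h1, dif_pos (h1.trans h), M.map_map]
  · intro p q h hq y
    obtain ⟨h1, h2⟩ := (hR q).1 hq
    rw [dif_pos h2, dif_pos (h.trans h2), LinearMap.smul_apply, LinearMap.smul_apply,
      LinearMap.comp_apply, LinearMap.comp_apply, M.map_map]

theorem IsExact.rectangleDecomposable [Finite α] [Finite β]
    {M : PersistenceModule.{u, v, max w w'} k (α × β)} (hM : M.IsExact) (hfd : M.IsPfd) :
    M.RectangleDecomposable := by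
  have := Fintype.ofFinite (α × β)
  induction hn : ∑ p, Module.finrank k (M.space p) using Nat.strong_induction_on generalizing M with
  | _ n ih =>
    by_cases h0 : ∃ p, Nontrivial (M.space p)
    · obtain ⟨R, hR, ⟨S⟩⟩ := hM.exists_splitting h0
      obtain ⟨ι, B, hB, hB'⟩ := ih _ (hn ▸ S.sum_finrank_compl_lt hfd hR.isInterval.nonempty)
        (hM.compl S) (S.isPfd_compl hfd) rfl
      refine ⟨Option ι, _, ?_, S.hasBarcode hR.isInterval hB'⟩
      rintro (_ | i)
      exacts [hR, hB i]
    · simp only [not_exists, not_nontrivial_iff_subsingleton] at h0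
      refine ⟨Empty, Empty.elim, fun i => i.elim, fun i => i.elim, fun p => ?_, fun p q h x => ?_⟩
      · have := h0 p
        exact (0 : M.space p ≃ₗ[k] DirectSum Empty fun i => indicatorSpace k (Empty.elim i) p)
      · exact DFinsupp.ext fun i => i.elim

end bimodules

end PersistenceModule

theorem theorem1 {k : Type u} [Field k] (X Y : Set ℝ) (hX : X.Finite) (hY : Y.Finite)
    (M : PersistenceModule.{u, v, 0} k (X × Y)) (hM : M.IsPfd) :
    M.RectangleDecomposable ↔ M.WeaklyExact := by
  have := hX.to_subtype
  have := hY.to_subtype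
  refine ⟨fun h s t hst => ?_, fun h => h.isExact.rectangleDecomposable hM⟩
  obtain ⟨ι, B, hB, hB'⟩ := (h.isExact.comap_corners s t hst).rectangleDecomposable
    fun p => hM (PersistenceModule.corners s t hst p)
  exact ⟨ι, B, fun i => PersistenceModule.mem_squareRectangles_iff.2 (hB i), hB'⟩
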